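/- For a Noetherian local ring $(R,\mathfrak m)$ let $H_R(l)=\operatorname{length}_R(R/\mathfrak m^{l+1})$, $l\in\mathbb N$, be its Hilbert–Samuel function, and for a point $b$ of a locally Noetherian scheme $X$ put $H_{X,b}=H_{\mathcal O_{X,b}}$. Let $r,m\ge 0$, let $B=\langle x_1,\dots,x_r,y_1^{\pm1},\dots,y_m^{\pm1}\rangle\cong\mathbb N^r\times\mathbb Z^m$, let $A$ be a cancellative torsion-free commutative monoid, and let $\varphi:B\to A$ be a surjective monoid homomorphism such that no $\varphi(x_i)$ is a unit of $A$. Let $I\subset\mathbb Z[B]=\mathbb Z[x_1,\dots,x_r,y_1^{\pm1},\dots,y_m^{\pm1}]$ be the kernel of the induced ring homomorphism $\mathbb Z[B]\to\mathbb Z[A]$, and let $X=\operatorname{Spec}(\mathbb Z[B]/I)\hookrightarrow M=\operatorname{Spec}\mathbb Z[B]$ be the corresponding affine embedded toric $\Lambda$-scheme. (The condition on $\varphi(x_i)$ says that $I$ is generated by binomials of the forms $x^\alpha-x^\beta y^\gamma$ with $1\le|\alpha|\le|\beta|$ and $1-y^\gamma$, where $\alpha,\beta\in\mathbb N^r$,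 $\gamma\in\mathbb Z^m$.) Let $a\in X$ be the distinguished point, i.e. the point given by the prime ideal $(x_1,\dots,x_r,y_1-1,\dots,y_m-1)$, which contains $I$. For a prime ideal $(p)$ of $\mathbb Z$ (including $p=0$) let $X_p$ be the scheme-theoretic fiber of $X\to\operatorname{Spec}\mathbb Z$ over $(p)$, and let $(p,a)_p\in X_p$ be its distinguished point, i.e. the point of $X_p$ corresponding to the point $(p,a)\in X$ given by the prime ideal $(p,x_1,\dots,x_r,y_1-1,\dots,y_m-1)$. Then for every prime ideal $(p)$ of $\mathbb Z$, including $p=0$, $$H_{X,a}=H_{X_p,(p,a)_p}.$$ -/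

import Mathlib

open AlgebraicGeometry CategoryTheory

noncomputable section

namespace ToricHS

/-! ### Hilbert-Samuel functions -/

/-- The Hilbert-Samuel function `l ↦ length (R / 𝔪 ^ (l + 1))` of a local ring `R`. Lengths are
taken in `ℕ∞`; they are finite when `R` is Noetherian. -/
def hilbertSamuelRing (R : Type*) [CommRing R] [IsLocalRing R] (l : ℕ) : ℕ∞ :=
  Module.length R (R ⧸ IsLocalRing.maximalIdeal R ^ (l + 1))

/-- The Hilbert-Samuel function of a scheme at a point: that of the local ring at the point. -/
def hilbertSamuel (X : Scheme) (x : X) : ℕ → ℕ∞ :=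
  hilbertSamuelRing (X.presheaf.stalk x)

/-! ### The ambient affine smooth toric scheme -/

/-- The free monoid `⟨x₁, …, x_r, y₁^±, …, y_m^±⟩` of a regular cone, written additively: the
pair `(α, γ)` stands for the monomial `x ^ α * y ^ γ`. -/
abbrev RegularMonoid (r m : ℕ) : Type := (Fin r → ℕ) × (Fin m → ℤ)

/-- The ring `ℤ[x₁, …, x_r, y₁^±, …, y_m^±]`, as the monoid algebra of `RegularMonoid r m`. -/
abbrev AmbientRing (r m : ℕ) : Type := AddMonoidAlgebra ℤ (RegularMonoid r m)

variable {r m : ℕ}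

/-- The exponent of the variable `x_i`. -/
def xExp (i : Fin r) : RegularMonoid r m := (Pi.single i 1, 0)

/-- The exponent of the variable `y_j`. -/
def yExp (j : Fin m) : RegularMonoid r m := (0, Pi.single j 1)

/-- The variable `x_i`. -/
def xVar (i : Fin r) : AmbientRing r m := AddMonoidAlgebra.single (xExp i) 1

/-- The variable `y_j`. -/
def yVar (j : Fin m) : AmbientRing r m := AddMonoidAlgebra.single (yExp j) 1

variable (r m) in
/-- The ideal `𝔭 = (x₁, …, x_r, y₁ - 1, …, y_m - 1)`. -/
def distinguishedIdeal : Ideal (AmbientRing r m) :=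
  Ideal.span (Set.range xVar ∪ Set.range fun j => yVar j - 1)

variable (r m) in
/-- The ideal `(p, x₁, …, x_r, y₁ - 1, …, y_m - 1)`, where `q = (p)` is an ideal of `ℤ`. -/
def distinguishedIdealAt (q : Ideal ℤ) : Ideal (AmbientRing r m) :=
  q.map (algebraMap ℤ (AmbientRing r m)) ⊔ distinguishedIdeal r m

/-! ### The embedded affine toric scheme -/

section Embedded

variable {A : Type*} [AddCommMonoid A]

/-- The ideal `I` of `ℤ[x₁, …, x_r, y₁^±, …, y_m^±]` cutting out `Spec ℤ[A]`: the kernel of the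
homomorphism of monoid algebras induced by `φ`. -/
def toricIdeal (φ : RegularMonoid r m →+ A) : Ideal (AmbientRing r m) :=
  RingHom.ker (AddMonoidAlgebra.mapDomainRingHom ℤ φ)

/-- The coordinate ring `ℤ[x₁, …, x_r, y₁^±, …, y_m^±] / I` of the embedded toric scheme. -/
abbrev ToricRing (φ : RegularMonoid r m →+ A) : Type := AmbientRing r m ⧸ toricIdeal φ

/-- The affine embedded toric scheme `X`. -/
abbrev toricScheme (φ : RegularMonoid r m →+ A) : Scheme :=
  Spec (CommRingCat.of (ToricRing φ))

/-- The structure morphism `X ⟶ Spec ℤ`. -/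
abbrev toricStructure (φ : RegularMonoid r m →+ A) :
    toricScheme φ ⟶ Spec (CommRingCat.of ℤ) :=
  Spec.map (CommRingCat.ofHom (algebraMap ℤ (ToricRing φ)))

/-- No variable `x_i` becomes invertible on `X`. -/
def NoUnitVariable (φ : RegularMonoid r m →+ A) : Prop :=
  ∀ i : Fin r, ¬ IsAddUnit (φ (xExp i))

/-! The distinguished points. The next declarations check that the ideals `𝔭` and `(p, 𝔭)` are
prime, contain `I`, and lie over the zero ideal and over `(p)`. -/

open Classical in
/-- The ring homomorphism `ℤ[A] → ℤ` that sends units of the monoid to `1`, non-units to `0`. -/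
def unitAug (A : Type*) [AddCommMonoid A] : AddMonoidAlgebra ℤ A →ₐ[ℤ] ℤ :=
  AddMonoidAlgebra.lift ℤ ℤ A
    { toFun := fun a => if IsAddUnit a.toAdd then 1 else 0
      map_one' := by simp
      map_mul' := fun a b => by
        simp only [toAdd_mul, IsAddUnit.add_iff]
        split_ifs <;> simp_all }

open Classical in
theorem unitAug_single (a : A) (n : ℤ) :
    unitAug A (AddMonoidAlgebra.single a n) = if IsAddUnit a then n else 0 := by
  simp [unitAug]

theorem isAddUnit_iff (b : RegularMonoid r m) : IsAddUnit b ↔ b.1 = 0 := by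
  rw [Prod.isAddUnit_iff]
  constructor
  · rintro ⟨h, -⟩
    rw [Pi.isAddUnit_iff] at h
    funext i
    exact Nat.isAddUnit_iff.mp (h i)
  · intro h
    refine ⟨by rw [h]; exact isAddUnit_zero, AddGroup.isAddUnit _⟩

theorem isAddUnit_map_iff {φ : RegularMonoid r m →+ A} (hφ : NoUnitVariable φ)
    (b : RegularMonoid r m) : IsAddUnit (φ b) ↔ IsAddUnit b := by
  refine ⟨fun h => ?_, fun h => h.map φ⟩
  rw [isAddUnit_iff]
  by_contra hb
  obtain ⟨i, hi⟩ := Function.ne_iff.mp hb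
  have hi' : 1 ≤ b.1 i := Nat.one_le_iff_ne_zero.mpr hi
  have hle : Pi.single i 1 ≤ b.1 := by
    intro j
    rcases eq_or_ne j i with rfl | hj
    · simpa using hi'
    · simp [hj]
  have key : b = xExp i + (b.1 - Pi.single i 1, b.2) :=
    Prod.ext (by simp [xExp, add_tsub_cancel_of_le hle]) (by simp [xExp])
  rw [key, map_add, IsAddUnit.add_iff] at h
  exact hφ i h.1

theorem unitAug_map {φ : RegularMonoid r m →+ A} (hφ : NoUnitVariable φ) (f : AmbientRing r m) :
    unitAug A (AddMonoidAlgebra.mapDomainRingHom ℤ φ f) = unitAug (RegularMonoid r m) f := by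
  induction f using AddMonoidAlgebra.induction_linear with
  | zero => simp
  | add f g hf hg => simp only [map_add, hf, hg]
  | single b n =>
    rw [AddMonoidAlgebra.mapDomainRingHom_apply, AddMonoidAlgebra.mapDomain_single,
      unitAug_single, unitAug_single]
    by_cases hb : IsAddUnit b
    · rw [if_pos hb, if_pos ((isAddUnit_map_iff hφ b).mpr hb)]
    · rw [if_neg hb, if_neg (mt (isAddUnit_map_iff hφ b).mp hb)]

theorem yVar_unit_mem (γ : Fin m → ℤ) :
    (AddMonoidAlgebra.single (0, γ) 1 - 1 : AmbientRing r m) ∈ distinguishedIdeal r m := by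
  let e : (Fin m → ℤ) → AmbientRing r m := fun γ => AddMonoidAlgebra.single (0, γ) 1
  have e_add : ∀ γ δ, e (γ + δ) = e γ * e δ := by
    intro γ δ
    simp [e, AddMonoidAlgebra.single_mul_single]
  have e_zero : e 0 = 1 := rfl
  let S : AddSubgroup (Fin m → ℤ) :=
    { carrier := {γ | e γ - 1 ∈ distinguishedIdeal r m}
      zero_mem' := by
        rw [Set.mem_ofPred_eq, e_zero, sub_self]
        exact zero_mem _
      add_mem' := by
        intro γ δ hγ hδ
        rw [Set.mem_ofPred_eq] at hγ hδ ⊢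
        have h := add_mem (Ideal.mul_mem_right (e δ) _ hγ) hδ
        rw [e_add]
        convert h using 1
        ring
      neg_mem' := by
        intro γ hγ
        rw [Set.mem_ofPred_eq] at hγ ⊢
        have h := neg_mem (Ideal.mul_mem_left _ (e (-γ)) hγ)
        have h1 := e_add (-γ) γ
        rw [neg_add_cancel, e_zero] at h1
        convert h using 1
        rw [mul_sub, ← h1]
        ring }
  suffices h : γ ∈ S from h
  have hγ : γ = ∑ j, γ j • (Pi.single j 1 : Fin m → ℤ) := by
    funext k
    simp [Finset.sum_apply, Pi.single_apply]
  rw [hγ]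
  refine sum_mem fun j _ => zsmul_mem ?_ _
  change yVar j - 1 ∈ distinguishedIdeal r m
  exact Ideal.subset_span (Or.inr ⟨j, rfl⟩)

theorem sub_algebraMap_unitAug_mem (f : AmbientRing r m) :
    f - algebraMap ℤ (AmbientRing r m) (unitAug _ f) ∈ distinguishedIdeal r m := by
  induction f using AddMonoidAlgebra.induction_linear with
  | zero => simp
  | add f g hf hg =>
    rw [map_add, map_add, add_sub_add_comm]
    exact add_mem hf hg
  | single b n =>
    rw [unitAug_single]
    by_cases hb : b.1 = 0
    · rw [if_pos ((isAddUnit_iff b).mpr hb)]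
      obtain ⟨α, γ⟩ := b
      obtain rfl : α = 0 := hb
      have h := Ideal.mul_mem_left _ (algebraMap ℤ (AmbientRing r m) n) (yVar_unit_mem (r := r) γ)
      convert h using 1
      rw [mul_sub, mul_one, ← Algebra.smul_def, AddMonoidAlgebra.smul_single, smul_eq_mul, mul_one]
    · rw [if_neg (mt (isAddUnit_iff b).mp hb), map_zero, sub_zero]
      obtain ⟨i, hi⟩ := Function.ne_iff.mp hb
      have hle : Pi.single i 1 ≤ b.1 := by
        intro j
        rcases eq_or_ne j i with rfl | hj
        · simpa using Nat.one_le_iff_ne_zero.mpr hi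
        · simp [hj]
      have key : b = xExp i + (b.1 - Pi.single i 1, b.2) :=
        Prod.ext (by simp [xExp, add_tsub_cancel_of_le hle]) (by simp [xExp])
      rw [key, ← one_mul n, ← AddMonoidAlgebra.single_mul_single]
      exact Ideal.mul_mem_right _ _ (Ideal.subset_span (Or.inl ⟨i, rfl⟩))

theorem distinguishedIdealAt_eq (q : Ideal ℤ) :
    distinguishedIdealAt r m q = q.comap (unitAug (RegularMonoid r m)) := by
  apply le_antisymm
  · refine sup_le (Ideal.map_le_iff_le_comap.mpr fun n hn => ?_) (Ideal.span_le.mpr ?_)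
    · simpa [Ideal.mem_comap] using hn
    · rintro _ (⟨i, rfl⟩ | ⟨j, rfl⟩)
      · have h : unitAug (RegularMonoid r m) (xVar i) = 0 := by
          refine (unitAug_single _ _).trans (if_neg ?_)
          rw [isAddUnit_iff]
          simp [xExp]
        simp [h]
      · have h : unitAug (RegularMonoid r m) (yVar j) = 1 := by
          refine (unitAug_single _ _).trans (if_pos ?_)
          rw [isAddUnit_iff]
          simp [yExp]
        simp [h]
  · intro f hf
    have h := sub_algebraMap_unitAug_mem f
    have h' : algebraMap ℤ (AmbientRing r m) (unitAug _ f) ∈ distinguishedIdealAt r m q :=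
      Ideal.mem_sup_left (Ideal.mem_map_of_mem _ hf)
    have h2 : f - algebraMap ℤ (AmbientRing r m) (unitAug _ f) ∈ distinguishedIdealAt r m q :=
      Ideal.mem_sup_right h
    have h3 := add_mem h2 h'
    rwa [sub_add_cancel] at h3

theorem distinguishedIdealAt_bot :
    distinguishedIdealAt r m ⊥ = distinguishedIdeal r m := by
  simp [distinguishedIdealAt]

theorem toricIdeal_le {φ : RegularMonoid r m →+ A} (hφ : NoUnitVariable φ) (q : Ideal ℤ) :
    toricIdeal φ ≤ distinguishedIdealAt r m q := by
  intro f hf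
  have h0 : AddMonoidAlgebra.mapDomainRingHom ℤ φ f = 0 := hf
  rw [distinguishedIdealAt_eq, Ideal.mem_comap, ← unitAug_map hφ, h0, map_zero]
  exact zero_mem _

theorem isPrime_distinguishedIdealAt (q : Ideal ℤ) [q.IsPrime] :
    (distinguishedIdealAt r m q).IsPrime := by
  rw [distinguishedIdealAt_eq]; infer_instance

theorem isPrime_map_distinguishedIdealAt {φ : RegularMonoid r m →+ A} (hφ : NoUnitVariable φ)
    (q : Ideal ℤ) [q.IsPrime] :
    ((distinguishedIdealAt r m q).map (Ideal.Quotient.mk (toricIdeal φ))).IsPrime := by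
  have := isPrime_distinguishedIdealAt (r := r) (m := m) q
  refine Ideal.map_isPrime_of_surjective Ideal.Quotient.mk_surjective ?_
  rw [Ideal.mk_ker]; exact toricIdeal_le hφ q

/-- The distinguished point `a` of `X`, given by the ideal `𝔭`. -/
def distinguishedPoint (φ : RegularMonoid r m →+ A) (hφ : NoUnitVariable φ) : toricScheme φ :=
  (⟨(distinguishedIdeal r m).map (Ideal.Quotient.mk (toricIdeal φ)), by
    rw [← distinguishedIdealAt_bot]; exact isPrime_map_distinguishedIdealAt hφ ⊥⟩ :
    PrimeSpectrum (ToricRing φ))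

/-- The point `(p, a)` of `X`, given by the ideal `(p, 𝔭)`. -/
def distinguishedPointAt (φ : RegularMonoid r m →+ A) (hφ : NoUnitVariable φ)
    (p : PrimeSpectrum ℤ) : toricScheme φ :=
  (⟨(distinguishedIdealAt r m p.asIdeal).map (Ideal.Quotient.mk (toricIdeal φ)),
    isPrime_map_distinguishedIdealAt hφ p.asIdeal⟩ : PrimeSpectrum (ToricRing φ))

theorem toricStructure_distinguishedPointAt (φ : RegularMonoid r m →+ A) (hφ : NoUnitVariable φ)
    (p : PrimeSpectrum ℤ) :
    toricStructure φ (distinguishedPointAt φ hφ p) = p := by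
  apply PrimeSpectrum.ext
  change ((distinguishedIdealAt r m p.asIdeal).map (Ideal.Quotient.mk (toricIdeal φ))).comap
    (algebraMap ℤ (ToricRing φ)) = p.asIdeal
  have h : algebraMap ℤ (ToricRing φ) =
      (Ideal.Quotient.mk (toricIdeal φ)).comp (algebraMap ℤ (AmbientRing r m)) :=
    RingHom.ext_int _ _
  rw [h, ← Ideal.comap_comap,
    Ideal.comap_map_of_surjective' _ Ideal.Quotient.mk_surjective, Ideal.mk_ker,
    sup_eq_left.mpr (toricIdeal_le hφ _), distinguishedIdealAt_eq]
  ext n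
  simp [Ideal.mem_comap]

/-- The fiber `X_p` of `X` over the point `(p)` of `Spec ℤ`. -/
abbrev toricFiber (φ : RegularMonoid r m →+ A) (p : PrimeSpectrum ℤ) : Scheme :=
  (toricStructure φ).fiber p

/-- The distinguished point `(p, a)_p` of the fiber `X_p`: the point of `X_p` that corresponds to
the point `(p, a)` of `X`. -/
def fiberDistinguishedPoint (φ : RegularMonoid r m →+ A) (hφ : NoUnitVariable φ)
    (p : PrimeSpectrum ℤ) : toricFiber φ p :=
  ((toricStructure φ).fiberHomeo p).symm
    ⟨distinguishedPointAt φ hφ p, toricStructure_distinguishedPointAt φ hφ p⟩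

end Embedded

end ToricHS

end

/-!
Let `U` be the group of units of `A` and `R = ℤ[A]` the coordinate ring of the toric scheme `X`. The
prime `𝔭` of the distinguished point is the kernel of the augmentation `R → ℤ` that sends units of
`A` to `1` and non-units to `0`. The theorem follows from the fact that all quotients `R / 𝔭 ^ L` are
free `ℤ`-modules of finite rank: for any field `κ` the ideal `𝔭 (κ ⊗ R)` is maximal with residue
field `κ`, so the Hilbert-Samuel function of `κ ⊗ R` at this ideal is
`dim_κ (κ ⊗ R / 𝔭 ^ (l + 1)) = rank_ℤ (R / 𝔭 ^ (l + 1))`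
(`ToricHS.hilbertSamuelRing_localization_baseChange`). The fiber of `X` over `(p)` is the case where
`κ` is the residue field of `(p)`, and the local ring of `X` at `𝔭` is the local ring of `ℚ ⊗ R`,
because it contains `ℚ` (`ToricHS.hilbertSamuelRing_localization`).

The quotients are finitely generated over `ℤ` since `R / 𝔭 = ℤ`; the point is that they have no
torsion. As `A` is cancellative, `R` is the direct sum of the free `ℤ[U]`-modules `ℤ[U] a` of rank
one, one for each coset `a + U`. If `J` is the augmentation ideal of `ℤ[U]`, then `𝔭 ^ L` is the
direct sum of the `J ^ (L - t) a`, where `t` is the order of `a`, the largest number with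
`a ∈ 𝔭 ^ t` (read `L - t` as `0` for `t ≥ L`). The inclusion that takes work is
`ToricHS.augIdeal_pow_le_cosetFiltration`. This reduces the question to `ℤ[U] / J ^ s`
(`ToricHS.mem_augIdeal_pow_of_smul_mem_of_units`). Finally `U` is free, because `A` is torsion-free
and `U` is generated by the images of the `y_j`, and for a free group with basis `y` the substitution
`y_j = 1 + z_j` embeds `ℤ[U] / J ^ s` into the truncated polynomial ring `ℤ[z] / (z) ^ s`
(`ToricHS.mem_augIdeal_pow_of_smul_mem_of_free`).
-/

noncomputable section

namespace ToricHS

/-! ### Graded pieces of a monoid algebra over the algebra of its units -/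

section Units

variable (A : Type*) [AddCancelCommMonoid A]

/-- The inclusion `ℤ[U] → ℤ[A]`, where `U` is the group of units of `A`. -/
def unitsInclusion : AddMonoidAlgebra ℤ (AddUnits A) →+* AddMonoidAlgebra ℤ A :=
  AddMonoidAlgebra.mapDomainRingHom ℤ (AddUnits.coeHom A)

variable {A}

theorem unitsInclusion_single (u : AddUnits A) (n : ℤ) :
    unitsInclusion A (AddMonoidAlgebra.single u n) =
      AddMonoidAlgebra.single (u : A) n := by
  simp [unitsInclusion]

theorem add_unit_injective (a : A) : Function.Injective fun u : AddUnits A => a + (u : A) :=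
  fun _ _ h => AddUnits.ext (add_left_cancel h)

/-- The coordinate of `f : ℤ[A]` along the coset `a + U`: the element `g` of `ℤ[U]` such that
`g * single a 1` is the part of `f` supported on `a + U`. -/
def cosetCoord (a : A) : AddMonoidAlgebra ℤ A →+ AddMonoidAlgebra ℤ (AddUnits A) :=
  AddMonoidAlgebra.comapDomainAddMonoidHom (fun u : AddUnits A => a + (u : A))
    (add_unit_injective a)

theorem coeff_cosetCoord (a : A) (f : AddMonoidAlgebra ℤ A) (u : AddUnits A) :
    (cosetCoord a f).coeff u = f.coeff (a + u) := by
  simp [cosetCoord, AddMonoidAlgebra.comapDomainAddMonoidHom]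

theorem cosetCoord_single_add (a : A) (u : AddUnits A) (n : ℤ) :
    cosetCoord a (AddMonoidAlgebra.single (a + u) n) = AddMonoidAlgebra.single u n :=
  AddMonoidAlgebra.comapDomain_single_map (fun u : AddUnits A => a + (u : A))
    (add_unit_injective a) u n

theorem cosetCoord_single_of_notMem {a b : A} (h : ∀ u : AddUnits A, a + u ≠ b) (n : ℤ) :
    cosetCoord a (AddMonoidAlgebra.single b n) = 0 := by
  apply AddMonoidAlgebra.ext
  ext u
  rw [coeff_cosetCoord, AddMonoidAlgebra.coeff_single, Finsupp.single_eq_of_ne (h u)]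
  rfl

theorem cosetCoord_unitsInclusion_mul (a : A) (g : AddMonoidAlgebra ℤ (AddUnits A))
    (f : AddMonoidAlgebra ℤ A) :
    cosetCoord a (unitsInclusion A g * f) = g * cosetCoord a f := by
  induction g using AddMonoidAlgebra.induction_linear with
  | zero => simp
  | add g₁ g₂ h₁ h₂ => simp only [map_add, add_mul, h₁, h₂]
  | single v k =>
    induction f using AddMonoidAlgebra.induction_linear with
    | zero => simp
    | add f₁ f₂ h₁ h₂ => simp only [map_add, mul_add, h₁, h₂]
    | single b n =>
      rw [unitsInclusion_single, AddMonoidAlgebra.single_mul_single]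
      by_cases hb : ∃ u : AddUnits A, a + u = b
      · obtain ⟨u, rfl⟩ := hb
        have h : (v : A) + (a + u) = a + ((v + u : AddUnits A) : A) := by
          rw [AddUnits.val_add, add_left_comm]
        rw [h, cosetCoord_single_add, cosetCoord_single_add, AddMonoidAlgebra.single_mul_single]
      · push Not at hb
        rw [cosetCoord_single_of_notMem hb, mul_zero, cosetCoord_single_of_notMem]
        intro u hu
        refine hb (u - v) ?_
        apply add_left_cancel (a := (v : A))
        rw [← hu, add_left_comm, ← AddUnits.val_add, add_sub_cancel]

theorem cosetCoord_add_single_mul (a b : A) (f : AddMonoidAlgebra ℤ A) :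
    cosetCoord (b + a) (AddMonoidAlgebra.single b 1 * f) = cosetCoord a f := by
  apply AddMonoidAlgebra.ext
  ext u
  rw [coeff_cosetCoord, coeff_cosetCoord, add_assoc, AddMonoidAlgebra.coeff_single_mul_add,
    one_mul]

theorem cosetCoord_single_mul_of_notMem {a b : A} (h : ∀ c, b + c ≠ a)
    (f : AddMonoidAlgebra ℤ A) :
    cosetCoord a (AddMonoidAlgebra.single b 1 * f) = 0 := by
  apply AddMonoidAlgebra.ext
  ext u
  rw [coeff_cosetCoord, AddMonoidAlgebra.coeff_single_mul_of_forall_add_ne]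
  · rfl
  · intro c hu
    refine h (c + ((-u : AddUnits A) : A)) ?_
    rw [← add_assoc, hu, add_assoc, ← AddUnits.val_add, add_neg_cancel, AddUnits.val_zero,
      add_zero]

theorem coeff_unitsInclusion_mul_single (a : A) (g : AddMonoidAlgebra ℤ (AddUnits A))
    (u : AddUnits A) :
    (unitsInclusion A g * AddMonoidAlgebra.single a 1).coeff (a + u) = g.coeff u := by
  rw [← coeff_cosetCoord, cosetCoord_unitsInclusion_mul]
  have h := cosetCoord_single_add a 0 1
  rw [AddUnits.val_zero, add_zero] at h
  rw [h, ← AddMonoidAlgebra.one_def, mul_one]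

theorem coeff_unitsInclusion_mul_single_of_notMem {a b : A}
    (h : ∀ u : AddUnits A, a + u ≠ b) (g : AddMonoidAlgebra ℤ (AddUnits A)) :
    (unitsInclusion A g * AddMonoidAlgebra.single a 1).coeff b = 0 := by
  induction g using AddMonoidAlgebra.induction_linear with
  | zero => simp
  | add g₁ g₂ h₁ h₂ => simp [add_mul, h₁, h₂]
  | single v k =>
    rw [unitsInclusion_single, AddMonoidAlgebra.single_mul_single, AddMonoidAlgebra.coeff_single,
      Finsupp.single_eq_of_ne]
    rintro rfl
    exact h v (add_comm _ _)

/-- An ideal of `ℤ[A]` that contains the part of `f` on every coset of `U` contains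
`f`, because `f` is the sum of these parts. -/
theorem mem_of_cosetCoord_mem (I : Ideal (AddMonoidAlgebra ℤ A)) (f : AddMonoidAlgebra ℤ A)
    (h : ∀ a, unitsInclusion A (cosetCoord a f) * AddMonoidAlgebra.single a 1 ∈ I) : f ∈ I := by
  induction hn : f.coeff.support.card using Nat.strong_induction_on generalizing f with
  | _ n ih =>
    subst hn
    by_cases hf : f = 0
    · rw [hf]; exact zero_mem _
    have hc : f.coeff ≠ 0 := mt AddMonoidAlgebra.coeff_eq_zero.mp hf
    obtain ⟨a, ha⟩ := Finsupp.support_nonempty_iff.mpr hc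
    set g := unitsInclusion A (cosetCoord a f) * AddMonoidAlgebra.single a 1 with hg
    -- subtracting the part on `a + U` kills the coefficients on `a + U` and keeps the others
    have h₁ : ∀ u : AddUnits A, (f - g).coeff (a + u) = 0 := by
      intro u
      rw [AddMonoidAlgebra.coeff_sub, Finsupp.sub_apply, hg, coeff_unitsInclusion_mul_single,
        coeff_cosetCoord, sub_self]
    have h₂ : ∀ b, (∀ u : AddUnits A, a + u ≠ b) → (f - g).coeff b = f.coeff b := by
      intro b hb
      rw [AddMonoidAlgebra.coeff_sub, Finsupp.sub_apply, hg,
        coeff_unitsInclusion_mul_single_of_notMem hb, sub_zero]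
    have key : f - g ∈ I := by
      refine ih _ (Finset.card_lt_card ?_) (f - g) ?_ rfl
      · rw [Finset.ssubset_iff_of_subset]
        · refine ⟨a, ha, ?_⟩
          have := h₁ 0
          rw [AddUnits.val_zero, add_zero] at this
          simpa using this
        · intro b hb
          rw [Finsupp.mem_support_iff] at hb ⊢
          rwa [h₂ b] at hb
          rintro u rfl
          exact hb (h₁ u)
      · intro b
        by_cases hb : ∃ v : AddUnits A, a + v = b
        · obtain ⟨v, rfl⟩ := hb
          have : cosetCoord (a + v) (f - g) = 0 := by
            apply AddMonoidAlgebra.ext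
            ext u
            rw [coeff_cosetCoord, add_assoc, ← AddUnits.val_add, h₁]
            rfl
          rw [this, map_zero, zero_mul]
          exact zero_mem _
        · push Not at hb
          have : cosetCoord b (f - g) = cosetCoord b f := by
            apply AddMonoidAlgebra.ext
            ext u
            rw [coeff_cosetCoord, coeff_cosetCoord, h₂]
            intro v hv
            refine hb (v - u) ?_
            have h3 : a + ((v - u : AddUnits A) : A) + u = b + u := by
              rw [add_assoc, ← AddUnits.val_add, sub_add_cancel, hv]
            exact add_right_cancel h3
          rw [this]
          exact h b
    have := add_mem key (h a)
    rwa [← hg, sub_add_cancel] at this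

end Units

/-! ### Powers of the augmentation ideal -/

section Augmentation

variable (A : Type*) [AddCancelCommMonoid A]

/-- The ideal of `ℤ[A]` generated by the non-units of `A` and the differences `u - 1`, where `u`
is a unit of `A`; it is encoded as the kernel of `unitAug`. -/
def augIdeal : Ideal (AddMonoidAlgebra ℤ A) := RingHom.ker (unitAug A)

variable {A}

theorem single_mem_augIdeal {a : A} (ha : ¬ IsAddUnit a) (n : ℤ) :
    AddMonoidAlgebra.single a n ∈ augIdeal A :=
  (unitAug_single a n).trans (if_neg ha)

theorem unitAug_unitsInclusion (g : AddMonoidAlgebra ℤ (AddUnits A)) :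
    unitAug A (unitsInclusion A g) = unitAug (AddUnits A) g := by
  induction g using AddMonoidAlgebra.induction_linear with
  | zero => simp
  | add g₁ g₂ h₁ h₂ => simp only [map_add, h₁, h₂]
  | single u n =>
    rw [unitsInclusion_single, unitAug_single, unitAug_single, if_pos u.isAddUnit,
      if_pos (AddGroup.isAddUnit u)]

theorem map_unitsInclusion_augIdeal_le :
    (augIdeal (AddUnits A)).map (unitsInclusion A) ≤ augIdeal A :=
  Ideal.map_le_iff_le_comap.mpr fun g hg => (unitAug_unitsInclusion g).trans hg

theorem augIdeal_eq_span :
    augIdeal A = Ideal.span (unitsInclusion A '' augIdeal (AddUnits A) ∪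
      (fun b => AddMonoidAlgebra.single b 1) '' {b : A | ¬ IsAddUnit b}) := by
  apply le_antisymm
  · intro f hf
    suffices h : ∀ f : AddMonoidAlgebra ℤ A, f - algebraMap ℤ _ (unitAug A f) ∈
        Ideal.span (unitsInclusion A '' augIdeal (AddUnits A) ∪
          (fun b => AddMonoidAlgebra.single b 1) '' {b : A | ¬ IsAddUnit b}) by
      have h1 := h f
      rwa [show unitAug A f = 0 from hf, map_zero, sub_zero] at h1
    intro f
    induction f using AddMonoidAlgebra.induction_linear with
    | zero => simp
    | add f₁ f₂ h₁ h₂ =>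
      rw [map_add, map_add, add_sub_add_comm]
      exact add_mem h₁ h₂
    | single b n =>
      rw [unitAug_single]
      by_cases hb : IsAddUnit b
      · obtain ⟨u, rfl⟩ := hb
        rw [if_pos u.isAddUnit]
        refine Ideal.subset_span (Or.inl ⟨AddMonoidAlgebra.single u n - algebraMap ℤ _ n, ?_, ?_⟩)
        · change unitAug _ _ = 0
          rw [map_sub, AlgHom.commutes, unitAug_single, if_pos (AddGroup.isAddUnit u)]
          exact sub_self n
        · rw [map_sub, unitsInclusion_single]
          simp
      · rw [if_neg hb, map_zero, sub_zero]
        have : AddMonoidAlgebra.single b n =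
            AddMonoidAlgebra.single 0 n * AddMonoidAlgebra.single b (1 : ℤ) := by
          rw [AddMonoidAlgebra.single_mul_single, zero_add, mul_one]
        rw [this]
        exact Ideal.mul_mem_left _ _ (Ideal.subset_span (Or.inr ⟨b, hb, rfl⟩))
  · rw [Ideal.span_le]
    rintro _ (⟨g, hg, rfl⟩ | ⟨b, hb, rfl⟩)
    · exact map_unitsInclusion_augIdeal_le (Ideal.mem_map_of_mem _ hg)
    · exact single_mem_augIdeal hb 1

/-- Multiplication by a monomial `b` moves the coset `a + U` to the coset `b + a + U`, and raises
the order `t` of a monomial if `b` is not a unit. -/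
theorem cosetCoord_single_mul_mem {k L : ℕ} {b : A}
    (hb : AddMonoidAlgebra.single b 1 ∈ augIdeal A ^ k) (f : AddMonoidAlgebra ℤ A)
    (hf : ∀ a t, AddMonoidAlgebra.single a 1 ∉ augIdeal A ^ (t + 1) →
      cosetCoord a f ∈ augIdeal (AddUnits A) ^ (L - t)) (a : A) (t : ℕ)
    (ha : AddMonoidAlgebra.single a 1 ∉ augIdeal A ^ (t + 1)) :
    cosetCoord a (AddMonoidAlgebra.single b 1 * f) ∈ augIdeal (AddUnits A) ^ (L + k - t) := by
  by_cases h : ∃ c, b + c = a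
  · obtain ⟨c, rfl⟩ := h
    rw [cosetCoord_add_single_mul]
    have hs : AddMonoidAlgebra.single (b + c) (1 : ℤ) =
        AddMonoidAlgebra.single b 1 * AddMonoidAlgebra.single c 1 := by
      rw [AddMonoidAlgebra.single_mul_single, one_mul]
    have hkt : k ≤ t := by
      by_contra hlt
      refine ha (hs ▸ Ideal.mul_mem_right _ _ (Ideal.pow_le_pow_right ?_ hb))
      omega
    have := hf c (t - k) fun hc => ha ?_
    · rwa [show L + k - t = L - (t - k) by omega]
    · rw [hs, show t + 1 = k + (t - k + 1) by omega, pow_add]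
      exact Ideal.mul_mem_mul hb hc
  · push Not at h
    rw [cosetCoord_single_mul_of_notMem h]
    exact zero_mem _

variable (A) in
/-- The elements of `ℤ[A]` whose coordinate on every coset `a + U` lies in the power `L - t` of
the augmentation ideal of `ℤ[U]`, where `t` is the order of the monomial `a`. The order enters
through its upper bounds: it is at most `t` if `a` is not in the power `t + 1` of `augIdeal A`. -/
def cosetFiltration (L : ℕ) : Ideal (AddMonoidAlgebra ℤ A) where
  carrier := {f | ∀ a t, AddMonoidAlgebra.single a 1 ∉ augIdeal A ^ (t + 1) →
    cosetCoord a f ∈ augIdeal (AddUnits A) ^ (L - t)}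
  zero_mem' := fun a t _ => by
    rw [map_zero]
    exact zero_mem _
  add_mem' := fun hf hg a t h => by
    rw [map_add]
    exact add_mem (hf a t h) (hg a t h)
  smul_mem' := fun c f hf a t ha => by
    rw [smul_eq_mul]
    induction c using AddMonoidAlgebra.induction_linear with
    | zero => simp
    | add c₁ c₂ h₁ h₂ =>
      rw [add_mul, map_add]
      exact add_mem h₁ h₂
    | single b n =>
      have : AddMonoidAlgebra.single b n = n • AddMonoidAlgebra.single b (1 : ℤ) := by
        rw [AddMonoidAlgebra.smul_single, smul_eq_mul, mul_one]
      rw [this, smul_mul_assoc, map_zsmul]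
      refine zsmul_mem ?_ n
      exact cosetCoord_single_mul_mem (k := 0) (by simp) f hf a t ha

theorem augIdeal_pow_le_cosetFiltration (L : ℕ) : augIdeal A ^ L ≤ cosetFiltration A L := by
  induction L with
  | zero =>
    intro f _ a t _
    simp
  | succ L ih =>
    rw [pow_succ']
    refine (mul_le_mul_right ih _).trans ?_
    rw [Ideal.mul_le]
    intro g hg f hf
    rw [augIdeal_eq_span] at hg
    induction hg using Submodule.span_induction with
    | zero => simp
    | add x y _ _ hx hy =>
      rw [add_mul]
      exact add_mem hx hy
    | smul c x _ hx =>
      rw [smul_eq_mul, mul_assoc]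
      exact Ideal.mul_mem_left _ _ hx
    | mem x hx =>
      rcases hx with ⟨g, hg, rfl⟩ | ⟨b, hb, rfl⟩
      · intro a t ha
        rw [cosetCoord_unitsInclusion_mul]
        refine Ideal.pow_le_pow_right (show L + 1 - t ≤ L - t + 1 by omega) ?_
        rw [pow_succ']
        exact Ideal.mul_mem_mul hg (hf a t ha)
      · intro a t ha
        refine cosetCoord_single_mul_mem (k := 1) ?_ f hf a t ha
        rw [pow_one]
        exact single_mem_augIdeal hb 1

/-- Torsion-freeness of `ℤ[A]` modulo the powers of `augIdeal A` can be checked on the group of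
units of `A`. -/
theorem mem_augIdeal_pow_of_smul_mem_of_units
    (hU : ∀ (s : ℕ) (n : ℤ) (g : AddMonoidAlgebra ℤ (AddUnits A)), n ≠ 0 →
      n • g ∈ augIdeal (AddUnits A) ^ s → g ∈ augIdeal (AddUnits A) ^ s)
    (L : ℕ) {n : ℤ} (hn : n ≠ 0) {f : AddMonoidAlgebra ℤ A} (hf : n • f ∈ augIdeal A ^ L) :
    f ∈ augIdeal A ^ L := by
  refine mem_of_cosetCoord_mem _ f fun a => ?_
  by_cases haL : AddMonoidAlgebra.single a 1 ∈ augIdeal A ^ L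
  · exact Ideal.mul_mem_left _ _ haL
  -- `t` is the order of the monomial `a`
  obtain ⟨t, htL, ht, ht'⟩ : ∃ t < L, AddMonoidAlgebra.single a 1 ∈ augIdeal A ^ t ∧
      AddMonoidAlgebra.single a 1 ∉ augIdeal A ^ (t + 1) := by
    by_contra! h
    have : ∀ t ≤ L, AddMonoidAlgebra.single a 1 ∈ augIdeal A ^ t := by
      intro t
      induction t with
      | zero => simp
      | succ t ih => exact fun hle => h t (by omega) (ih (by omega))
    exact haL (this L le_rfl)
  have h := augIdeal_pow_le_cosetFiltration L hf a t ht'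
  rw [map_zsmul] at h
  have h' := Ideal.mem_map_of_mem (unitsInclusion A) (hU _ n _ hn h)
  rw [Ideal.map_pow] at h'
  have h'' := Ideal.mul_mem_mul (Ideal.pow_right_mono map_unitsInclusion_augIdeal_le _ h') ht
  rwa [← pow_add, show L - t + t = L by omega] at h''

end Augmentation

/-! ### The group algebra of a free abelian group -/

section FreeGroup

variable {U ι : Type*} [AddCommGroup U]

/-- Algebra homomorphisms out of the group algebra of a free abelian group are determined by their
values on a basis. -/
theorem algHom_ext_basis {C : Type*} [CommRing C] [Algebra ℤ C] (b : Module.Basis ι ℤ U)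
    {f g : AddMonoidAlgebra ℤ U →ₐ[ℤ] C}
    (h : ∀ j, f (AddMonoidAlgebra.single (b j) 1) = g (AddMonoidAlgebra.single (b j) 1)) :
    f = g := by
  let toUnits (f : AddMonoidAlgebra ℤ U →ₐ[ℤ] C) : U →+ Additive Cˣ :=
    AddMonoidHom.toMultiplicativeLeft.symm
      (MonoidHom.toHomUnits ((f : AddMonoidAlgebra ℤ U →* C).comp (AddMonoidAlgebra.of ℤ U)))
  have key : (toUnits f).toIntLinearMap = (toUnits g).toIntLinearMap := by
    refine b.ext fun j => ?_
    apply Additive.toMul.injective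
    exact Units.ext (h j)
  refine AddMonoidAlgebra.algHom_ext (fun u => ?_) (Subsingleton.elim _ _)
  exact congrArg Units.val (congrArg Additive.toMul (LinearMap.congr_fun key u))

/-- The algebra homomorphism out of the group algebra of a free abelian group with prescribed
invertible values on a basis. -/
def liftBasis {C : Type*} [CommRing C] [Algebra ℤ C] (b : Module.Basis ι ℤ U) (y : ι → Cˣ) :
    AddMonoidAlgebra ℤ U →ₐ[ℤ] C :=
  AddMonoidAlgebra.lift ℤ C U ((Units.coeHom C).comp (AddMonoidHom.toMultiplicativeLeft
    (b.constr ℤ fun j => Additive.ofMul (y j)).toAddMonoidHom))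

theorem liftBasis_single {C : Type*} [CommRing C] [Algebra ℤ C] (b : Module.Basis ι ℤ U)
    (y : ι → Cˣ) (j : ι) :
    liftBasis b y (AddMonoidAlgebra.single (b j) 1) = y j := by
  rw [liftBasis, AddMonoidAlgebra.lift_single, Algebra.smul_def, map_one, one_mul]
  simp

variable (b : Module.Basis ι ℤ U) (s : ℕ)

theorem isUnit_one_add_X (j : ι) :
    IsUnit (1 + Ideal.Quotient.mk (MvPolynomial.idealOfVars ι ℤ ^ s) (MvPolynomial.X j)) := by
  refine IsNilpotent.isUnit_one_add ⟨s, ?_⟩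
  have hX : MvPolynomial.X j ∈ MvPolynomial.idealOfVars ι ℤ := Ideal.subset_span ⟨j, rfl⟩
  rw [← map_pow, Ideal.Quotient.eq_zero_iff_mem]
  exact Ideal.pow_mem_pow hX s

/-- The homomorphism from the group algebra of a free abelian group with basis `y` to the truncated
polynomial ring that sends `y_j` to `1 + z_j`. -/
def truncatedExpansion :
    AddMonoidAlgebra ℤ U →ₐ[ℤ] MvPolynomial ι ℤ ⧸ MvPolynomial.idealOfVars ι ℤ ^ s :=
  liftBasis b fun j => (isUnit_one_add_X s j).unit

theorem truncatedExpansion_single (j : ι) :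
    truncatedExpansion b s (AddMonoidAlgebra.single (b j) 1) =
      1 + Ideal.Quotient.mk _ (MvPolynomial.X j) :=
  liftBasis_single b _ j

theorem truncatedExpansion_eq_zero {g : AddMonoidAlgebra ℤ U}
    (hg : g ∈ augIdeal U ^ s) : truncatedExpansion b s g = 0 := by
  set K : Ideal (MvPolynomial ι ℤ ⧸ MvPolynomial.idealOfVars ι ℤ ^ s) :=
    (MvPolynomial.idealOfVars ι ℤ).map (Ideal.Quotient.mk _) with hK
  have hle : augIdeal U ≤ K.comap (truncatedExpansion b s) := by
    have key : (Ideal.Quotient.mkₐ ℤ K).comp (truncatedExpansion b s) =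
        (Algebra.ofId ℤ (_ ⧸ K)).comp (unitAug U) := by
      refine algHom_ext_basis (C := _ ⧸ K) b fun j => ?_
      rw [AlgHom.comp_apply, AlgHom.comp_apply, truncatedExpansion_single, unitAug_single,
        if_pos (AddGroup.isAddUnit _), map_add, map_one, map_one, add_eq_left,
        Ideal.Quotient.mkₐ_eq_mk, Ideal.Quotient.eq_zero_iff_mem]
      exact Ideal.mem_map_of_mem _ (Ideal.subset_span ⟨j, rfl⟩)
    intro f hf
    rw [Ideal.mem_comap, ← Ideal.Quotient.eq_zero_iff_mem]
    have h := AlgHom.congr_fun key f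
    rw [AlgHom.comp_apply, AlgHom.comp_apply, show unitAug U f = 0 from hf, map_zero] at h
    exact h
  have h := (Ideal.pow_right_mono hle s).trans (Ideal.le_comap_pow _ s) hg
  rw [Ideal.mem_comap, hK, ← Ideal.map_pow, Ideal.map_quotient_self] at h
  exact h

/-- The inverse of `truncatedExpansion` modulo the power `s` of the augmentation ideal. -/
def truncatedSubstitution :
    MvPolynomial ι ℤ ⧸ MvPolynomial.idealOfVars ι ℤ ^ s →ₐ[ℤ]
      AddMonoidAlgebra ℤ U ⧸ augIdeal U ^ s :=
  Ideal.Quotient.liftₐ _ ((Ideal.Quotient.mkₐ ℤ _).comp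
    (MvPolynomial.aeval fun j => AddMonoidAlgebra.single (b j) 1 - 1)) (by
      intro p hp
      rw [AlgHom.comp_apply, Ideal.Quotient.mkₐ_eq_mk, Ideal.Quotient.eq_zero_iff_mem]
      have hle : MvPolynomial.idealOfVars ι ℤ ≤ (augIdeal U).comap
          (MvPolynomial.aeval (R := ℤ)
            fun j => (AddMonoidAlgebra.single (b j) 1 - 1 : AddMonoidAlgebra ℤ U)) := by
        rw [Ideal.span_le]
        rintro _ ⟨j, rfl⟩
        rw [SetLike.mem_coe, Ideal.mem_comap, MvPolynomial.aeval_X]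
        change unitAug _ _ = 0
        rw [map_sub, unitAug_single, if_pos (AddGroup.isAddUnit _), map_one, sub_self]
      exact (Ideal.pow_right_mono hle s).trans (Ideal.le_comap_pow _ s) hp)

theorem truncatedSubstitution_truncatedExpansion (g : AddMonoidAlgebra ℤ U) :
    truncatedSubstitution b s (truncatedExpansion b s g) = Ideal.Quotient.mk _ g := by
  suffices h : (truncatedSubstitution b s).comp (truncatedExpansion b s) =
      Ideal.Quotient.mkₐ ℤ (augIdeal U ^ s) from AlgHom.congr_fun h g
  refine algHom_ext_basis b fun j => ?_
  rw [AlgHom.comp_apply, truncatedExpansion_single, map_add, map_one]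
  have h : truncatedSubstitution b s (Ideal.Quotient.mk _ (MvPolynomial.X j)) =
      Ideal.Quotient.mk (augIdeal U ^ s) (MvPolynomial.aeval
        (fun j => (AddMonoidAlgebra.single (b j) 1 - 1 : AddMonoidAlgebra ℤ U))
        (MvPolynomial.X j : MvPolynomial ι ℤ)) := rfl
  rw [h, MvPolynomial.aeval_X, map_sub, map_one, add_sub_cancel]
  rfl

/-- Modulo a power of its augmentation ideal, the group algebra of a free abelian group is
torsion-free: it embeds into a truncated polynomial ring. -/
theorem mem_augIdeal_pow_of_smul_mem_of_free [Module.Free ℤ U] (s : ℕ) (n : ℤ)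
    (g : AddMonoidAlgebra ℤ U) (hn : n ≠ 0) (hg : n • g ∈ augIdeal U ^ s) :
    g ∈ augIdeal U ^ s := by
  let b := Module.Free.chooseBasis ℤ U
  have h := truncatedExpansion_eq_zero b s hg
  rw [map_zsmul] at h
  have h0 : truncatedExpansion b s g = 0 := by
    obtain ⟨p, hp⟩ := Ideal.Quotient.mk_surjective (truncatedExpansion b s g)
    rw [← hp] at h ⊢
    rw [← map_zsmul, Ideal.Quotient.eq_zero_iff_mem, MvPolynomial.mem_pow_idealOfVars_iff'] at h
    rw [Ideal.Quotient.eq_zero_iff_mem, MvPolynomial.mem_pow_idealOfVars_iff']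
    intro x hx
    have := h x hx
    rw [MvPolynomial.coeff_smul, smul_eq_mul] at this
    exact (mul_eq_zero.mp this).resolve_left hn
  rw [← Ideal.Quotient.eq_zero_iff_mem, ← truncatedSubstitution_truncatedExpansion b s g, h0,
    map_zero]

end FreeGroup

/-! ### Hilbert-Samuel functions of base changes -/

section HilbertSamuel

open TensorProduct

theorem hilbertSamuelRing_congr {R S : Type*} [CommRing R] [CommRing S] [IsLocalRing R]
    [IsLocalRing S] (e : R ≃+* S) : hilbertSamuelRing R = hilbertSamuelRing S := by
  funext l
  let _ : Algebra R S := e.toRingHom.toAlgebra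
  have hmap : IsLocalRing.maximalIdeal S ^ (l + 1) =
      (IsLocalRing.maximalIdeal R ^ (l + 1)).map (algebraMap R S) := by
    have h : IsLocalRing.maximalIdeal S = (IsLocalRing.maximalIdeal R).map e :=
      (IsLocalRing.eq_maximalIdeal (Ideal.map_isMaximal_of_equiv e)).symm
    rw [Ideal.map_pow, h]
    rfl
  let f : (R ⧸ IsLocalRing.maximalIdeal R ^ (l + 1)) ≃ₐ[R]
      (S ⧸ IsLocalRing.maximalIdeal S ^ (l + 1)) :=
    Ideal.quotientEquivAlg _ _ (AlgEquiv.ofRingEquiv (f := e) fun _ => rfl) hmap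
  exact f.toLinearEquiv.length_eq.trans (Module.length_eq_of_surjective e.surjective)

/-- Over a local algebra whose residue field is the base field, lengths are dimensions. -/
theorem length_eq_of_surjective_residueField {κ B M : Type*} [Field κ] [CommRing B]
    [IsLocalRing B] [Algebra κ B] [AddCommGroup M] [Module κ M] [Module B M] [IsScalarTower κ B M]
    (h : Function.Surjective (algebraMap κ (IsLocalRing.ResidueField B))) :
    Module.length κ M = Module.length B M := by
  have hlen : Module.length (IsLocalRing.ResidueField κ) (IsLocalRing.ResidueField B) = 1 := by
    rw [Module.length_eq_of_surjective (R := IsLocalRing.ResidueField B), Module.length_eq_one]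
    intro x
    obtain ⟨c, rfl⟩ := h x
    exact ⟨IsLocalRing.residue κ c, rfl⟩
  rw [IsLocalRing.length_restrictScalars κ B M, hlen, mul_one]

variable {κ R : Type*} [Field κ] [CommRing R]

/-- The quotient of a ring by the kernel of an augmentation `R → ℤ` is `ℤ`. -/
theorem bijective_algebraMap_quotient_of_ker {P : Ideal R} {ε : R →+* ℤ}
    (hε : RingHom.ker ε = P) : Function.Bijective (algebraMap ℤ (R ⧸ P)) := by
  constructor
  · rw [injective_iff_map_eq_zero]
    intro n hn
    have h : (n : R) ∈ P := by
      rw [← Ideal.Quotient.eq_zero_iff_mem, map_intCast]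
      simpa using hn
    simpa [← hε, RingHom.mem_ker] using h
  · intro x
    obtain ⟨f, rfl⟩ := Ideal.Quotient.mk_surjective x
    refine ⟨ε f, ?_⟩
    have h : (ε f : R) - f ∈ P := by
      simp [← hε, RingHom.mem_ker]
    rw [← (Ideal.Quotient.eq (I := P)).mpr h]
    simp

theorem free_quotient_pow {P : Ideal R} (L : ℕ) [Module.Finite ℤ (R ⧸ P ^ L)]
    (h : ∀ (n : ℤ) (f : R), n ≠ 0 → n * f ∈ P ^ L → f ∈ P ^ L) : Module.Free ℤ (R ⧸ P ^ L) := by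
  have : Module.IsTorsionFree ℤ (R ⧸ P ^ L) := by
    rw [Module.isTorsionFree_iff_smul_eq_zero]
    intro n x hx
    rw [or_iff_not_imp_left]
    intro hn
    obtain ⟨f, rfl⟩ := Ideal.Quotient.mk_surjective x
    rw [← map_zsmul, Ideal.Quotient.eq_zero_iff_mem, zsmul_eq_mul] at hx
    exact Ideal.Quotient.eq_zero_iff_mem.mpr (h n f hn hx)
  exact Module.free_of_finite_type_torsion_free'

theorem finite_quotient_pow {P : Ideal R} (hP : Function.Bijective (algebraMap ℤ (R ⧸ P)))
    (hfg : P.FG) (L : ℕ) : Module.Finite ℤ (R ⧸ P ^ L) := by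
  rcases Nat.eq_zero_or_pos L with rfl | hL
  · rw [pow_zero, Ideal.one_eq_top]
    infer_instance
  have hfin : Module.Finite ℤ (R ⧸ P) :=
    Module.Finite.of_surjective (Algebra.linearMap ℤ (R ⧸ P)) hP.2
  have hle : P ^ L ≤ P := Ideal.pow_le_self hL.ne'
  let f : (R ⧸ P ^ L) →ₐ[ℤ] R ⧸ P := Ideal.Quotient.factorₐ ℤ hle
  have hker : RingHom.ker f = P.map (Ideal.Quotient.mk (P ^ L)) := Ideal.Quotient.factor_ker hle
  refine Module.finite_of_surjective_of_ker_le_nilradical f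
    (Ideal.Quotient.factor_surjective hle) ?_ ?_
  · rw [hker, Ideal.map_le_iff_le_comap]
    intro x hx
    refine mem_nilradical.mpr ⟨L, ?_⟩
    rw [← map_pow, Ideal.Quotient.eq_zero_iff_mem]
    exact Ideal.pow_mem_pow hx L
  · rw [hker]
    exact hfg.map _

/-- The quotient of a base change by a power of an extended ideal is the base change of the
quotient. -/
def baseChangeQuotientPowEquiv (P : Ideal R) (L : ℕ) :
    κ ⊗[ℤ] (R ⧸ P ^ L) ≃ₗ[κ] (κ ⊗[ℤ] R) ⧸ P.map
      (Algebra.TensorProduct.includeRight : R →ₐ[ℤ] κ ⊗[ℤ] R) ^ L :=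
  ((Algebra.TensorProduct.tensorQuotientEquiv (R := ℤ) κ R κ (P ^ L)).trans
    (Ideal.quotientEquivAlgOfEq κ (Ideal.map_pow _ P L))).toLinearEquiv

/-- If `R / P = ℤ`, then the residue ring of `κ ⊗ R` at the ideal extended from `P` is `κ`. -/
theorem bijective_algebraMap_baseChange_quotient {P : Ideal R}
    (hP : Function.Bijective (algebraMap ℤ (R ⧸ P))) :
    Function.Bijective (algebraMap κ ((κ ⊗[ℤ] R) ⧸ P.map
      (Algebra.TensorProduct.includeRight : R →ₐ[ℤ] κ ⊗[ℤ] R))) := by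
  let e : ((κ ⊗[ℤ] R) ⧸ P.map (Algebra.TensorProduct.includeRight : R →ₐ[ℤ] κ ⊗[ℤ] R)) ≃ₐ[κ] κ :=
    ((Algebra.TensorProduct.tensorQuotientEquiv (R := ℤ) κ R κ P).symm.trans
      (Algebra.TensorProduct.congr AlgEquiv.refl
        (AlgEquiv.ofBijective (Algebra.ofId ℤ (R ⧸ P)) hP).symm)).trans
      (Algebra.TensorProduct.rid ℤ κ κ)
  have h : ⇑(algebraMap κ ((κ ⊗[ℤ] R) ⧸ P.map
      (Algebra.TensorProduct.includeRight : R →ₐ[ℤ] κ ⊗[ℤ] R))) = e.symm := by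
    funext x
    exact (e.symm.commutes x).symm
  rw [h]
  exact e.symm.bijective

theorem isMaximal_map_includeRight {P : Ideal R}
    (hP : Function.Bijective (algebraMap ℤ (R ⧸ P))) :
    (P.map (Algebra.TensorProduct.includeRight : R →ₐ[ℤ] κ ⊗[ℤ] R)).IsMaximal := by
  apply Ideal.Quotient.maximal_of_isField
  exact (MulEquiv.isField (Field.toIsField κ)
    (RingEquiv.ofBijective _ (bijective_algebraMap_baseChange_quotient hP)).symm.toMulEquiv)

/-- If the quotients of `R` by the powers of `P` are finite free over `ℤ` and `R / P = ℤ`, then the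
Hilbert-Samuel function of a base change `κ ⊗ R` to a field at the prime ideal extended from `P`
does not depend on the field. -/
theorem hilbertSamuelRing_localization_baseChange {P : Ideal R}
    (hP : Function.Bijective (algebraMap ℤ (R ⧸ P))) (l : ℕ) [Module.Free ℤ (R ⧸ P ^ (l + 1))]
    [Module.Finite ℤ (R ⧸ P ^ (l + 1))] (n : Ideal (κ ⊗[ℤ] R)) [n.IsPrime]
    (hn : P.map (Algebra.TensorProduct.includeRight : R →ₐ[ℤ] κ ⊗[ℤ] R) = n) :
    hilbertSamuelRing (Localization.AtPrime n) l = Module.finrank ℤ (R ⧸ P ^ (l + 1)) := by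
  have hmax : n.IsMaximal := hn ▸ isMaximal_map_includeRight hP
  have hsurj : ∀ y, ∃ c : κ, Ideal.Quotient.mk n (algebraMap κ (κ ⊗[ℤ] R) c) = y := by
    subst hn
    exact (bijective_algebraMap_baseChange_quotient (κ := κ) hP).2
  have hres : Function.Surjective
      (algebraMap κ (IsLocalRing.ResidueField (Localization.AtPrime n))) := by
    intro x
    obtain ⟨y, rfl⟩ :=
      (IsLocalization.AtPrime.equivQuotMaximalIdeal n (Localization.AtPrime n)).surjective x
    obtain ⟨c, rfl⟩ := hsurj y
    exact ⟨c, rfl⟩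
  rw [hilbertSamuelRing, ← length_eq_of_surjective_residueField hres,
    ← ((IsLocalization.AtPrime.equivQuotMaximalIdealPow n (Localization.AtPrime n)
      (l + 1)).toLinearEquiv.restrictScalars κ).length_eq]
  subst hn
  rw [← (baseChangeQuotientPowEquiv P (l + 1)).length_eq, Module.length_eq_finrank,
    Module.finrank_baseChange]

attribute [local instance] Algebra.TensorProduct.rightAlgebra in
/-- The local ring of `R` at `P` has the Hilbert-Samuel function found in
`hilbertSamuelRing_localization_baseChange` for base changes to fields: it contains `ℚ`, and is
therefore a local ring of `ℚ ⊗ R`. -/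
theorem hilbertSamuelRing_localization {R : Type*} [CommRing R] {P : Ideal R} [P.IsPrime]
    (hP : Function.Bijective (algebraMap ℤ (R ⧸ P))) (l : ℕ) [Module.Free ℤ (R ⧸ P ^ (l + 1))]
    [Module.Finite ℤ (R ⧸ P ^ (l + 1))] :
    hilbertSamuelRing (Localization.AtPrime P) l = Module.finrank ℤ (R ⧸ P ^ (l + 1)) := by
  set n := P.map (Algebra.TensorProduct.includeRight : R →ₐ[ℤ] ℚ ⊗[ℤ] R) with hn
  have hmax : n.IsMaximal := isMaximal_map_includeRight hP
  have hcomap : n.comap (algebraMap R (ℚ ⊗[ℤ] R)) = P := by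
    apply le_antisymm
    · -- modulo `P`, an element of the left-hand side is an integer, which is a unit unless it is `0`
      intro r hr
      obtain ⟨k, hk⟩ := hP.2 (Ideal.Quotient.mk P r)
      have hrk : r - k ∈ P := by
        rw [← Ideal.Quotient.eq_zero_iff_mem, map_sub, map_intCast, ← hk]
        simp
      have hkn : ((k : ℤ) : ℚ ⊗[ℤ] R) ∈ n := by
        have h1 : algebraMap R (ℚ ⊗[ℤ] R) (r - k) ∈ n := Ideal.mem_map_of_mem _ hrk
        have h2 := sub_mem (Ideal.mem_comap.mp hr) h1
        rwa [map_sub, map_intCast, sub_sub_cancel] at h2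
      have hk0 : k = 0 := by
        by_contra hk0
        refine hmax.ne_top (Ideal.eq_top_of_isUnit_mem _ hkn ?_)
        have : IsUnit (k : ℚ) := by simpa using hk0
        simpa using this.map (algebraMap ℚ (ℚ ⊗[ℤ] R))
      simpa [hk0] using hrk
    · exact fun r hr => Ideal.mem_map_of_mem _ hr
  have := IsLocalization.isLocalization_isLocalization_atPrime_isLocalization
    (Algebra.algebraMapSubmonoid R (nonZeroDivisors ℤ)) (Localization.AtPrime n) n
  simp only [hcomap] at this
  rw [hilbertSamuelRing_congr
    (IsLocalization.algEquiv P.primeCompl (Localization.AtPrime P)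
      (Localization.AtPrime n)).toRingEquiv]
  exact hilbertSamuelRing_localization_baseChange hP l n hn.symm

end HilbertSamuel

/-! ### Local rings of the fibers of an affine scheme over `ℤ` -/

section Geometry

open TensorProduct Limits

theorem hilbertSamuel_eq_of_iso {X Y : Scheme} (e : X ≅ Y) (x : X) :
    hilbertSamuel X x = hilbertSamuel Y (e.hom x) :=
  (hilbertSamuelRing_congr (asIso (e.hom.stalkMap x)).commRingCatIsoToRingEquiv).symm

variable {R : Type} [CommRing R]

theorem hilbertSamuel_Spec (x : PrimeSpectrum R) :
    hilbertSamuel (Spec (CommRingCat.of R)) x =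
      hilbertSamuelRing (Localization.AtPrime x.asIdeal) := by
  let x' : Spec (CommRingCat.of R) := x
  let e : (Spec (CommRingCat.of R)).presheaf.stalk x' ≃+* Localization.AtPrime x.asIdeal :=
    (IsLocalization.algEquiv x.asIdeal.primeCompl ((Spec.structureSheaf R).presheaf.stalk x)
      (Localization.AtPrime x.asIdeal)).toRingEquiv
  have : IsLocalRing ((Spec (CommRingCat.of R)).presheaf.stalk x') := inferInstance
  exact hilbertSamuelRing_congr (R := (Spec (CommRingCat.of R)).presheaf.stalk x') e

variable (R) in
/-- The fiber of `Spec R → Spec ℤ` at a point `p` is the spectrum of the tensor product of `R` with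
the residue field of `p`. -/
theorem exists_pullback_iso_Spec (p : Spec (CommRingCat.of ℤ)) :
    ∃ e : pullback (Spec.map (CommRingCat.ofHom (algebraMap ℤ R)))
          ((Spec (CommRingCat.of ℤ)).fromSpecResidueField p) ≅
        Spec (CommRingCat.of ((Spec (CommRingCat.of ℤ)).residueField p ⊗[ℤ] R)),
      e.hom ≫ Spec.map (CommRingCat.ofHom (Algebra.TensorProduct.includeRight :
        R →ₐ[ℤ] (Spec (CommRingCat.of ℤ)).residueField p ⊗[ℤ] R).toRingHom) =
      pullback.fst _ _ := by
  have h : (Spec (CommRingCat.of ℤ)).fromSpecResidueField p = Spec.map (CommRingCat.ofHom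
      (algebraMap ℤ ((Spec (CommRingCat.of ℤ)).residueField p))) := by
    rw [← Spec.map_preimage ((Spec (CommRingCat.of ℤ)).fromSpecResidueField p)]
    congr 1
    ext1
    exact RingHom.ext_int _ _
  have H : IsPullback
      (Spec.map (CommRingCat.ofHom (Algebra.TensorProduct.includeRight :
        R →ₐ[ℤ] (Spec (CommRingCat.of ℤ)).residueField p ⊗[ℤ] R).toRingHom))
      (Spec.map (CommRingCat.ofHom Algebra.TensorProduct.includeLeftRingHom))
      (Spec.map (CommRingCat.ofHom (algebraMap ℤ R)))
      ((Spec (CommRingCat.of ℤ)).fromSpecResidueField p) := by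
    rw [h]
    exact isPullback_SpecMap_of_isPushout _ _ _ _
      (CommRingCat.isPushout_tensorProduct ℤ ((Spec (CommRingCat.of ℤ)).residueField p) R).flip
  exact ⟨(IsPullback.of_hasPullback _ _).isoIsPullback _ _ H,
    IsPullback.isoIsPullback_hom_fst _ _ _ H⟩

/-- Let `P` be the kernel of an augmentation `R → ℤ`, and suppose that the quotients of `R` by the
powers of `P` are torsion-free over `ℤ`. Then the local ring of `Spec R` at `P` has the same
Hilbert-Samuel function as the local ring of any fiber over `Spec ℤ` at a point above `P`: both are
given by the ranks of the free groups `R / P ^ (l + 1)`. The structure morphism is given by an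
arbitrary `g : ℤ →+* R`, so that it need not be syntactically `algebraMap ℤ R`. -/
theorem hilbertSamuel_eq_hilbertSamuel_fiber {P : Ideal R} {ε : R →+* ℤ}
    (hε : RingHom.ker ε = P) (hfg : P.FG)
    (htf : ∀ (L : ℕ) (n : ℤ) (f : R), n ≠ 0 → n * f ∈ P ^ L → f ∈ P ^ L) (g : ℤ →+* R)
    (x : PrimeSpectrum R) (hx : x.asIdeal = P) (p : Spec (CommRingCat.of ℤ))
    (y : (Spec.map (CommRingCat.ofHom g)).fiber p)
    (hy : P ≤ PrimeSpectrum.asIdeal ((Spec.map (CommRingCat.ofHom g)).fiberι p y)) :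
    hilbertSamuel (Spec (CommRingCat.of R)) x =
      hilbertSamuel ((Spec.map (CommRingCat.ofHom g)).fiber p) y := by
  funext l
  have hP := bijective_algebraMap_quotient_of_ker hε
  have := finite_quotient_pow hP hfg (l + 1)
  have := free_quotient_pow (l + 1) (htf (l + 1))
  obtain rfl : g = algebraMap ℤ R := RingHom.ext_int _ _
  have hX : hilbertSamuel (Spec (CommRingCat.of R)) x l =
      Module.finrank ℤ (R ⧸ P ^ (l + 1)) := by
    subst hx
    exact (congrFun (hilbertSamuel_Spec x) l).trans (hilbertSamuelRing_localization hP l)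
  obtain ⟨e, he⟩ := exists_pullback_iso_Spec R p
  let z : PrimeSpectrum ((Spec (CommRingCat.of ℤ)).residueField p ⊗[ℤ] R) := e.hom y
  have hle : P.map (Algebra.TensorProduct.includeRight : R →ₐ[ℤ]
      (Spec (CommRingCat.of ℤ)).residueField p ⊗[ℤ] R) ≤ z.asIdeal := by
    rw [Ideal.map_le_iff_le_comap]
    refine hy.trans (le_of_eq ?_)
    rw [Scheme.Hom.fiberι, ← he]
    rfl
  -- the ideal extended from `P` is maximal, so `y` is the only point of the fiber above `P`
  have heq := (isMaximal_map_includeRight hP).eq_of_le z.isPrime.ne_top hle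
  have hY : hilbertSamuel ((Spec.map (CommRingCat.ofHom (algebraMap ℤ R))).fiber p) y =
      hilbertSamuelRing (Localization.AtPrime z.asIdeal) :=
    (hilbertSamuel_eq_of_iso e y).trans (hilbertSamuel_Spec z)
  rw [hX, hY, hilbertSamuelRing_localization_baseChange hP l z.asIdeal heq]

end Geometry

/-! ### The coordinate ring of a toric scheme -/

section Toric

variable {r m : ℕ} {A : Type*} [AddCancelCommMonoid A]

/-- The group of units of `A` is free: it is torsion-free, and it is generated by the images of the
`y_j`, because no `x_i` becomes a unit. -/
theorem free_addUnits [IsAddTorsionFree A] {φ : RegularMonoid r m →+ A}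
    (hsurj : Function.Surjective φ) (hφ : NoUnitVariable φ) : Module.Free ℤ (AddUnits A) := by
  let ψ : (Fin m → ℤ) →+ AddUnits A :=
    (AddUnits.map φ).comp ((AddMonoidHom.inr (Fin r → ℕ) (Fin m → ℤ)).toHomAddUnits)
  have hψ : ∀ γ, (ψ γ : A) = φ (0, γ) := fun γ => rfl
  have hψs : Function.Surjective ψ.toIntLinearMap := by
    intro u
    obtain ⟨⟨α, γ⟩, hb⟩ := hsurj u
    have hu : IsAddUnit (φ (α, γ)) := hb ▸ u.isAddUnit
    obtain rfl : α = 0 := (isAddUnit_iff _).mp ((isAddUnit_map_iff hφ _).mp hu)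
    exact ⟨γ, AddUnits.ext ((hψ γ).trans hb)⟩
  have : Module.Finite ℤ (AddUnits A) := Module.Finite.of_surjective _ hψs
  have : IsAddTorsionFree (AddUnits A) :=
    Function.Injective.isAddTorsionFree (AddUnits.coeHom A) AddUnits.val_injective
  exact inferInstance

/-- The coordinate ring of the toric scheme is `ℤ[A]`. -/
def toricRingEquiv {φ : RegularMonoid r m →+ A} (hsurj : Function.Surjective φ) :
    ToricRing φ ≃+* AddMonoidAlgebra ℤ A :=
  RingHom.quotientKerEquivOfSurjective (f := AddMonoidAlgebra.mapDomainRingHom ℤ φ) (by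
    intro f
    induction f using AddMonoidAlgebra.induction_linear with
    | zero => exact ⟨0, map_zero _⟩
    | add f g hf hg =>
      obtain ⟨f, rfl⟩ := hf
      obtain ⟨g, rfl⟩ := hg
      exact ⟨f + g, map_add _ _ _⟩
    | single a n =>
      obtain ⟨b, rfl⟩ := hsurj a
      exact ⟨AddMonoidAlgebra.single b n, by simp⟩)

/-- The prime ideal of the distinguished point in the coordinate ring of the toric scheme. -/
def pointIdeal (φ : RegularMonoid r m →+ A) : Ideal (ToricRing φ) :=
  (distinguishedIdeal r m).map (Ideal.Quotient.mk (toricIdeal φ))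

theorem distinguishedIdeal_eq_ker :
    distinguishedIdeal r m = RingHom.ker (unitAug (RegularMonoid r m)) := by
  rw [← distinguishedIdealAt_bot, distinguishedIdealAt_eq]
  rfl

theorem comap_augIdeal {φ : RegularMonoid r m →+ A} (hsurj : Function.Surjective φ)
    (hφ : NoUnitVariable φ) :
    (augIdeal A).comap (toricRingEquiv hsurj) = pointIdeal φ := by
  apply Ideal.comap_injective_of_surjective (Ideal.Quotient.mk (toricIdeal φ))
    Ideal.Quotient.mk_surjective
  have h : toricIdeal φ ≤ distinguishedIdeal r m := by
    rw [← distinguishedIdealAt_bot]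
    exact toricIdeal_le hφ ⊥
  rw [pointIdeal, Ideal.comap_map_of_surjective' _ Ideal.Quotient.mk_surjective, Ideal.mk_ker,
    sup_eq_left.mpr h, distinguishedIdeal_eq_ker]
  ext f
  change unitAug A (AddMonoidAlgebra.mapDomainRingHom ℤ φ f) = 0 ↔ unitAug _ f = 0
  rw [unitAug_map hφ]

/-- The augmentation of `ℤ[A]` as a homomorphism on the coordinate ring of the toric scheme. -/
def toricAug {φ : RegularMonoid r m →+ A} (hsurj : Function.Surjective φ) : ToricRing φ →+* ℤ :=
  (unitAug A).toRingHom.comp (toricRingEquiv hsurj).toRingHom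

theorem ker_toricAug {φ : RegularMonoid r m →+ A} (hsurj : Function.Surjective φ)
    (hφ : NoUnitVariable φ) : RingHom.ker (toricAug hsurj) = pointIdeal φ := by
  rw [← comap_augIdeal hsurj hφ]
  rfl

theorem map_pointIdeal {φ : RegularMonoid r m →+ A} (hsurj : Function.Surjective φ)
    (hφ : NoUnitVariable φ) :
    (pointIdeal φ).map (toricRingEquiv hsurj) = augIdeal A := by
  rw [← comap_augIdeal hsurj hφ]
  exact Ideal.map_comap_of_surjective _ (toricRingEquiv hsurj).surjective _

/-- The quotients of the coordinate ring by the powers of `𝔭` are torsion-free over `ℤ`. -/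
theorem mem_pointIdeal_pow_of_mul_mem [IsAddTorsionFree A] {φ : RegularMonoid r m →+ A}
    (hsurj : Function.Surjective φ) (hφ : NoUnitVariable φ) (L : ℕ) (n : ℤ) (f : ToricRing φ)
    (hn : n ≠ 0) (hf : n * f ∈ pointIdeal φ ^ L) : f ∈ pointIdeal φ ^ L := by
  have := free_addUnits hsurj hφ
  have h := Ideal.mem_map_of_mem (toricRingEquiv hsurj) hf
  rw [Ideal.map_pow, map_pointIdeal hsurj hφ, map_mul, map_intCast, ← zsmul_eq_mul] at h
  have h' := mem_augIdeal_pow_of_smul_mem_of_units mem_augIdeal_pow_of_smul_mem_of_free L hn h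
  rw [← map_pointIdeal hsurj hφ, ← Ideal.map_pow] at h'
  obtain ⟨g, hg, hgf⟩ := (Ideal.mem_map_iff_of_surjective _ (toricRingEquiv hsurj).surjective).mp h'
  rwa [← (toricRingEquiv hsurj).injective hgf]

theorem fg_pointIdeal (φ : RegularMonoid r m →+ A) : (pointIdeal φ).FG :=
  Ideal.FG.map (Submodule.fg_span ((Set.finite_range _).union (Set.finite_range _))) _

end Toric

end ToricHS

end

theorem mainTheorem4 (r m : ℕ) (A : Type*) [AddCancelCommMonoid A] [IsAddTorsionFree A]
    (φ : ToricHS.RegularMonoid r m →+ A) (hsurj : Function.Surjective φ)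
    (hφ : ToricHS.NoUnitVariable φ) (p : PrimeSpectrum ℤ) :
    ToricHS.hilbertSamuel (ToricHS.toricScheme φ) (ToricHS.distinguishedPoint φ hφ) =
      ToricHS.hilbertSamuel (ToricHS.toricFiber φ p) (ToricHS.fiberDistinguishedPoint φ hφ p) := by
  refine ToricHS.hilbertSamuel_eq_hilbertSamuel_fiber (ToricHS.ker_toricAug hsurj hφ)
    (ToricHS.fg_pointIdeal φ) (ToricHS.mem_pointIdeal_pow_of_mul_mem hsurj hφ) _ _ rfl p _ ?_
  have h := (ToricHS.toricStructure φ).fiberι_fiberHomeo_symm p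
    ⟨ToricHS.distinguishedPointAt φ hφ p, ToricHS.toricStructure_distinguishedPointAt φ hφ p⟩
  exact (Ideal.map_mono le_sup_right).trans (congrArg PrimeSpectrum.asIdeal h).ge
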